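/- A Lie group is a second countable Hausdorff smooth ($C^\infty$) manifold modelled on some $\mathbb{R}^n$ (its dimension being $n$), equipped with a group structure whose multiplication and inversion are smooth; two Lie groups are isomorphic if there is a group isomorphism between them that is smooth with smooth inverse. For $k\ge 0$ let $T^k=S^1\times\cdots\times S^1$ ($k$ factors) be the $k$-torus, with the product Lie group structure (a point if $k=0$). Let $G$ be a connected $n$-dimensional abelian Lie group. Then there is an integer $k$ with $0\le k\le n$ such that $G$ is isomorphic, as a Lie group, to $T^k\times\mathbb{R}^{n-k}$. In particular, if $G$ is moreover compact, then $G$ is isomorphic, as a Lie group, to the torus $T^n$. -/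

import Mathlib

open scoped Manifold ContDiff

/-! ### Vector groups, written multiplicatively -/

/-- The manifold structure on the multiplicative copy of a manifold is the same manifold structure. -/
instance Multiplicative.instChartedSpace {H M : Type*} [TopologicalSpace H] [TopologicalSpace M]
    [ChartedSpace H M] : ChartedSpace H (Multiplicative M) :=
  inferInstanceAs (ChartedSpace H M)

/-- An additive Lie group, written multiplicatively, is a Lie group. -/
instance Multiplicative.instLieGroup {𝕜 : Type*} [NontriviallyNormedField 𝕜] {E H : Type*}
    [NormedAddCommGroup E] [NormedSpace 𝕜 E] [TopologicalSpace H] {I : ModelWithCorners 𝕜 E H}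
    {n : ℕ∞ω} {G : Type*} [AddGroup G] [TopologicalSpace G] [ChartedSpace H G]
    [h : LieAddGroup I n G] : LieGroup I n (Multiplicative G) where
  toIsManifold := h.toIsManifold
  contMDiff_mul := h.contMDiff_add
  contMDiff_inv := h.contMDiff_neg

/-! ### Finite products of Lie groups -/

section Pi

variable {𝕜 : Type*} [NontriviallyNormedField 𝕜] {ι : Type*} [Fintype ι]
  {E : Type*} [NormedAddCommGroup E] [NormedSpace 𝕜 E]
  {H : Type*} [TopologicalSpace H] {I : ModelWithCorners 𝕜 E H} {n : ℕ∞ω}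
  {M : Type*} [TopologicalSpace M] [ChartedSpace H M]
  {F : Type*} [NormedAddCommGroup F] [NormedSpace 𝕜 F]
  {K : Type*} [TopologicalSpace K] {J : ModelWithCorners 𝕜 F K}
  {N : Type*} [TopologicalSpace N] [ChartedSpace K N]

/-- Coordinate projections of a finite power of a manifold are smooth. -/
theorem contMDiff_piEval (i : ι) :
    ContMDiff (ModelWithCorners.pi fun _ : ι => I) I n (fun x : ι → M => x i) := by
  intro x
  rw [contMDiffAt_iff]
  refine ⟨(continuous_apply i).continuousAt, ?_⟩
  have : ContDiffWithinAt 𝕜 n (fun y : ι → E => y i)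
      (Set.range (ModelWithCorners.pi fun _ : ι => I))
      (extChartAt (ModelWithCorners.pi fun _ : ι => I) x x) :=
    (contDiff_apply 𝕜 E i).contDiffWithinAt
  refine this.congr_of_eventuallyEq_of_mem ?_ ?_
  · filter_upwards [extChartAt_target_mem_nhdsWithin (I := ModelWithCorners.pi fun _ : ι => I) x]
      with y hy
    refine (extChartAt I (x i)).right_inv ?_
    rw [extChartAt_target] at hy ⊢
    obtain ⟨hy, z, rfl⟩ := hy
    exact ⟨hy i trivial, z i, rfl⟩
  · exact Set.mem_range_self _

/-- A map into a finite power of a manifold is smooth if its coordinates are. -/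
theorem contMDiff_intoPi {f : N → ι → M} (hf : ∀ i, ContMDiff J I n fun x => f x i) :
    ContMDiff J (ModelWithCorners.pi fun _ : ι => I) n f := by
  intro x
  rw [contMDiffAt_iff]
  refine ⟨(continuous_pi fun i => (hf i).continuous).continuousAt, ?_⟩
  rw [contDiffWithinAt_pi]
  intro i
  exact (contMDiffAt_iff.1 (hf i x)).2

instance isManifold_pi [IsManifold I n M] :
    IsManifold (ModelWithCorners.pi fun _ : ι => I) n (ι → M) := by
  apply isManifold_of_contDiffOn
  rintro _ _ ⟨e, he, rfl⟩ ⟨e', he', rfl⟩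
  rw [contDiffOn_pi]
  intro i
  have h := (contDiffGroupoid n I).compatible (he i trivial) (he' i trivial)
  rw [contDiffGroupoid, mem_groupoid_of_pregroupoid] at h
  have h1 := h.1
  refine ContDiffOn.comp (f := fun y : ι → E => y i) h1 (contDiff_apply 𝕜 E i).contDiffOn ?_
  rintro y ⟨hy, z, rfl⟩
  exact ⟨⟨hy.1 i trivial, hy.2 i trivial⟩, z i, rfl⟩

instance lieGroup_pi {G : Type*} [Group G] [TopologicalSpace G] [ChartedSpace H G]
    [LieGroup I n G] : LieGroup (ModelWithCorners.pi fun _ : ι => I) n (ι → G) where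
  contMDiff_mul := contMDiff_intoPi fun i =>
    ((contMDiff_piEval i).comp contMDiff_fst).mul ((contMDiff_piEval i).comp contMDiff_snd)
  contMDiff_inv := contMDiff_intoPi fun i => (contMDiff_piEval i).inv

end Pi

/-- Two real Lie groups are isomorphic if there is a group isomorphism between them that is smooth
and has a smooth inverse. -/
def LieGroupIsomorphic {E E' H H' : Type*} [NormedAddCommGroup E] [NormedSpace ℝ E]
    [NormedAddCommGroup E'] [NormedSpace ℝ E'] [TopologicalSpace H] [TopologicalSpace H']
    (I : ModelWithCorners ℝ E H) (I' : ModelWithCorners ℝ E' H')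
    (G G' : Type*) [Group G] [TopologicalSpace G] [ChartedSpace H G] [LieGroup I ∞ G]
    [Group G'] [TopologicalSpace G'] [ChartedSpace H' G'] [LieGroup I' ∞ G'] : Prop :=
  ∃ φ : G ≃* G', ContMDiff I I' ∞ φ ∧ ContMDiff I' I ∞ φ.symm

/-- The `k`-torus `S¹ × ⋯ × S¹`, as a product group. -/
abbrev Torus (k : ℕ) : Type := Fin k → Circle

/-- The model of the product manifold structure on the `k`-torus. -/
noncomputable abbrev torusModel (k : ℕ) :
    ModelWithCorners ℝ (Fin k → EuclideanSpace ℝ (Fin 1))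
      (ModelPi fun _ : Fin k => EuclideanSpace ℝ (Fin 1)) :=
  ModelWithCorners.pi fun _ => 𝓡 1

/-- The Lie group `(ℝᵐ, +)`, written multiplicatively. -/
abbrev VectorGroup (m : ℕ) : Type := Multiplicative (EuclideanSpace ℝ (Fin m))

/-! In an abelian Lie group, the one-parameter subgroups tangent to the coordinate axes commute, so
their product is a smooth homomorphism `P` from ℝⁿ to `G` with identity derivative at 0
(`exists_contMDiff_monoidHom_hasFDerivAt_id`). The inverse function theorem makes `P` a local
diffeomorphism: its kernel is discrete and its image contains a neighbourhood of 1, hence is all of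
the connected group `G`.

A discrete subgroup of ℝⁿ is ℤᵏ × 0 in suitable linear coordinates
(`exists_continuousLinearEquiv_mem_iff_of_discrete`), which is also the kernel of the covering ℝᵏ ×
ℝⁿ⁻ᵏ → Tᵏ × ℝⁿ⁻ᵏ. Both groups are thus quotients of ℝⁿ by the same kernel, and smooth local sections
make the resulting isomorphism smooth both ways (`LieGroupIsomorphic.of_ker_eq`). Compactness rules
out a nonzero vector factor. -/

open Set Filter Topology

/-! ### Smooth homomorphisms and quotients by a common kernel -/

section LieGroupHom

variable {E H : Type*} [NormedAddCommGroup E] [NormedSpace ℝ E] [TopologicalSpace H]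
  {I : ModelWithCorners ℝ E H} {G : Type*} [Group G] [TopologicalSpace G] [ChartedSpace H G]
  {E' H' : Type*} [NormedAddCommGroup E'] [NormedSpace ℝ E'] [TopologicalSpace H']
  {I' : ModelWithCorners ℝ E' H'} {G' : Type*} [Group G'] [TopologicalSpace G']
  [ChartedSpace H' G']
  {F K : Type*} [NormedAddCommGroup F] [NormedSpace ℝ F] [TopologicalSpace K]
  {J : ModelWithCorners ℝ F K} {W : Type*} [Group W] [TopologicalSpace W] [ChartedSpace K W]

/-- A homomorphism of Lie groups that is smooth at the identity is smooth. -/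
theorem MonoidHom.contMDiff_of_contMDiffAt_one [LieGroup I ∞ G] [LieGroup I' ∞ G'] (f : G →* G')
    (hf : ContMDiffAt I I' ∞ f 1) : ContMDiff I I' ∞ f := by
  intro g
  have h : (f : G → G') = (fun y => f g * y) ∘ f ∘ (fun x => g⁻¹ * x) := by
    ext x; simp
  rw [h]
  refine (contMDiff_mul_left (I := I') (n := ∞)).contMDiffAt.comp g ?_
  refine ContMDiffAt.comp g ?_ (contMDiff_mul_left (I := I) (n := ∞)).contMDiffAt
  simpa using hf

/-- Two smooth surjective homomorphisms with the same kernel, both with smooth local sections at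
the identity, have isomorphic targets. -/
theorem LieGroupIsomorphic.of_ker_eq [LieGroup I ∞ G] [LieGroup I' ∞ G']
    {P : W →* G} {Q : W →* G'} (hP : Function.Surjective P) (hQ : Function.Surjective Q)
    (hker : P.ker = Q.ker) (hPs : ContMDiff J I ∞ P) (hQs : ContMDiff J I' ∞ Q)
    {σ : G → W} (hσ : ContMDiffAt I J ∞ σ 1) (hPσ : ∀ᶠ g in 𝓝 1, P (σ g) = g)
    {τ : G' → W} (hτ : ContMDiffAt I' J ∞ τ 1) (hQτ : ∀ᶠ g in 𝓝 1, Q (τ g) = g) :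
    LieGroupIsomorphic I I' G G' := by
  let φ : G ≃* G' := (QuotientGroup.quotientKerEquivOfSurjective P hP).symm.trans
    ((QuotientGroup.quotientMulEquivOfEq hker).trans
      (QuotientGroup.quotientKerEquivOfSurjective Q hQ))
  have hφ : ∀ w, φ (P w) = Q w := fun w => by
    have : (QuotientGroup.quotientKerEquivOfSurjective P hP).symm (P w) = (w : W ⧸ P.ker) := by
      rw [MulEquiv.symm_apply_eq]; rfl
    simp only [φ, MulEquiv.trans_apply, this]
    rfl
  have hφ' : ∀ w, φ.symm (Q w) = P w := fun w => by rw [← hφ, MulEquiv.symm_apply_apply]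
  refine ⟨φ, MonoidHom.contMDiff_of_contMDiffAt_one φ.toMonoidHom ?_,
    MonoidHom.contMDiff_of_contMDiffAt_one φ.symm.toMonoidHom ?_⟩
  -- Near 1 the abstract isomorphism is `Q ∘ σ`; its inverse is likewise `P ∘ τ`.
  · refine (hQs.contMDiffAt.comp 1 hσ).congr_of_eventuallyEq ?_
    filter_upwards [hPσ] with g hg
    change φ g = Q (σ g)
    rw [← hφ, hg]
  · refine (hPs.contMDiffAt.comp 1 hτ).congr_of_eventuallyEq ?_
    filter_upwards [hQτ] with g hg
    change φ.symm g = P (τ g)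
    rw [← hφ', hg]

end LieGroupHom

/-! ### Discrete subgroups of Euclidean space -/

section Lattice

/-- A discrete subgroup of a Euclidean space becomes `ℤᵏ × 0` in suitable linear coordinates. -/
theorem exists_continuousLinearEquiv_mem_iff_of_discrete {n : ℕ}
    (L : Submodule ℤ (EuclideanSpace ℝ (Fin n))) [DiscreteTopology L] :
    ∃ k ≤ n, ∃ A : ((Fin k → ℝ) × EuclideanSpace ℝ (Fin (n - k))) ≃L[ℝ] EuclideanSpace ℝ (Fin n),
      ∀ p, A p ∈ L ↔ p.2 = 0 ∧ ∃ m : Fin k → ℤ, ∀ i, p.1 i = m i := by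
  set V := EuclideanSpace ℝ (Fin n)
  let k := Module.finrank ℤ L
  let b : Module.Basis (Fin k) ℤ L := Module.finBasis ℤ L
  have hspan : Submodule.span ℤ (range fun i => (b i : V)) = L := by
    have : (range fun i => (b i : V)) = L.subtype '' range b := by
      rw [← range_comp]; rfl
    rw [this, ← Submodule.map_span, b.span_eq, Submodule.map_top, Submodule.range_subtype]
  have hdisc : DiscreteTopology (Submodule.span ℤ (range fun i => (b i : V))) := by
    rw [hspan]; infer_instance
  -- Discreteness enters here: it equates the rank over ℤ with that over ℝ, so a ℤ-basis stays
  -- independent over ℝ. This fails for ℤ + √2ℤ in ℝ.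
  have hrank : Set.finrank ℝ (range fun i => (b i : V)) = k := by
    rw [Real.finrank_eq_int_finrank_of_discrete hdisc, Set.finrank, hspan]
  have hli : LinearIndependent ℝ fun i => (b i : V) := by
    rw [linearIndependent_iff_card_eq_finrank_span, hrank, Fintype.card_fin]
  obtain ⟨C, hC⟩ := Submodule.exists_isCompl (Submodule.span ℝ (range fun i => (b i : V)))
  have hsum := Submodule.finrank_add_eq_of_isCompl hC
  rw [finrank_euclideanSpace_fin, show Module.finrank ℝ
    (Submodule.span ℝ (range fun i => (b i : V))) = k from hrank] at hsum
  have hCdim : Module.finrank ℝ (EuclideanSpace ℝ (Fin (n - k))) = Module.finrank ℝ C := by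
    rw [finrank_euclideanSpace_fin]; omega
  let e₁ := (Module.Basis.span hli).equivFun.symm
  let e₂ := LinearEquiv.ofFinrankEq _ _ hCdim
  let A := (e₁.prodCongr e₂).trans (Submodule.prodEquivOfIsCompl _ _ hC)
  have he₁ : ∀ x, (e₁ x : V) = ∑ i, x i • (b i : V) := fun x => by
    simp [e₁, Module.Basis.equivFun_symm_apply, Module.Basis.span_apply]
  have hA : ∀ p, A p = ∑ i, p.1 i • (b i : V) + e₂ p.2 := fun p => by
    simp [A, ← he₁]
  refine ⟨k, by omega, A.toContinuousLinearEquiv, fun p => ?_⟩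
  change A p ∈ L ↔ _
  constructor
  · intro h
    let m := b.repr ⟨A p, h⟩
    have hm : A p = A (fun i => (m i : ℝ), 0) := by
      have := congrArg (Subtype.val) (b.sum_repr ⟨A p, h⟩)
      rw [hA (fun i => (m i : ℝ), 0)]
      simp only [map_zero, Submodule.coe_zero, add_zero, Int.cast_smul_eq_zsmul]
      rw [Submodule.coe_sum] at this
      exact this.symm
    have := A.injective hm
    rw [this]
    exact ⟨rfl, m, fun i => rfl⟩
  · rintro ⟨h, m, hm⟩
    rw [hA, h]
    simp only [map_zero, Submodule.coe_zero, add_zero, hm]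
    refine Submodule.sum_mem _ fun i _ => ?_
    rw [Int.cast_smul_eq_zsmul]
    exact L.smul_mem _ (b i).2

end Lattice

/-! ### The covering of the torus times a vector group -/

section TorusCover

/-- The covering homomorphism `(x, y) ↦ (exp (2πi x₁), …, exp (2πi xₖ), y)`. -/
noncomputable def torusCover (k m : ℕ) :
    Multiplicative ((Fin k → ℝ) × EuclideanSpace ℝ (Fin m)) →* Torus k × VectorGroup m where
  toFun p := (fun i => Circle.exp (2 * Real.pi * p.toAdd.1 i), Multiplicative.ofAdd p.toAdd.2)
  map_one' := by ext <;> simp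
  map_mul' p q := by
    refine Prod.ext (funext fun i => ?_) rfl
    change Circle.exp (2 * Real.pi * (p.toAdd.1 i + q.toAdd.1 i)) = _
    rw [mul_add, Circle.exp_add]
    rfl

theorem mem_ker_torusCover {k m : ℕ} (p : Multiplicative ((Fin k → ℝ) × EuclideanSpace ℝ (Fin m))) :
    p ∈ (torusCover k m).ker ↔ p.toAdd.2 = 0 ∧ ∃ l : Fin k → ℤ, ∀ i, p.toAdd.1 i = l i := by
  have h : p ∈ (torusCover k m).ker ↔
      (∀ i, Circle.exp (2 * Real.pi * p.toAdd.1 i) = 1) ∧ p.toAdd.2 = 0 := by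
    rw [MonoidHom.mem_ker, Prod.ext_iff, funext_iff]
    rfl
  rw [h, and_comm]
  refine and_congr_right fun _ => ?_
  rw [← Classical.skolem (p := fun i (l : ℤ) => p.toAdd.1 i = l)]
  refine forall_congr' fun i => ?_
  rw [Circle.exp_eq_one]
  refine exists_congr fun l => ?_
  rw [mul_comm (l : ℝ), mul_right_inj' (by positivity)]

theorem contMDiff_torusCover (k m : ℕ) :
    ContMDiff 𝓘(ℝ, (Fin k → ℝ) × EuclideanSpace ℝ (Fin m)) ((torusModel k).prod (𝓡 m)) ∞
      (torusCover k m) := by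
  have h₁ : ContMDiff 𝓘(ℝ, (Fin k → ℝ) × EuclideanSpace ℝ (Fin m)) (torusModel k) ∞
      (fun (p : (Fin k → ℝ) × EuclideanSpace ℝ (Fin m)) (i : Fin k) =>
        Circle.exp (2 * Real.pi * p.1 i)) := by
    refine contMDiff_intoPi fun i => contMDiff_circleExp.comp ?_
    exact ContDiff.contMDiff (by fun_prop)
  have h₂ : ContMDiff 𝓘(ℝ, (Fin k → ℝ) × EuclideanSpace ℝ (Fin m)) (𝓡 m) ∞
      (fun p : (Fin k → ℝ) × EuclideanSpace ℝ (Fin m) => p.2) := contDiff_snd.contMDiff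
  exact h₁.prodMk h₂

/-- The smooth local section of `torusCover` given by the principal argument. -/
noncomputable def torusCoverSection (k m : ℕ) (q : Torus k × VectorGroup m) :
    Multiplicative ((Fin k → ℝ) × EuclideanSpace ℝ (Fin m)) :=
  Multiplicative.ofAdd (fun i => Complex.arg (q.1 i) / (2 * Real.pi), q.2.toAdd)

theorem torusCover_torusCoverSection {k m : ℕ} (q : Torus k × VectorGroup m) :
    torusCover k m (torusCoverSection k m q) = q := by
  refine Prod.ext (funext fun i => ?_) rfl
  change Circle.exp (2 * Real.pi * (Complex.arg (q.1 i) / (2 * Real.pi))) = _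
  rw [mul_div_cancel₀ _ (by positivity), Circle.exp_arg]

theorem torusCover_surjective (k m : ℕ) : Function.Surjective (torusCover k m) :=
  fun q => ⟨_, torusCover_torusCoverSection q⟩

/-- The argument is the imaginary part of the principal logarithm, which is smooth near 1, away from
the branch cut. -/
theorem contMDiffAt_circle_arg_one :
    ContMDiffAt (𝓡 1) 𝓘(ℝ, ℝ) ∞ (fun z : Circle => Complex.arg z) 1 := by
  have h : ContDiffAt ℝ ∞ (fun z : ℂ => (Complex.log z).im) ((1 : Circle) : ℂ) := by
    have := (Complex.imCLM.contDiff (n := ∞)).contDiffAt.comp ((1 : Circle) : ℂ)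
      ((Complex.contDiffAt_log (n := ∞) (x := ((1 : Circle) : ℂ)) (by simp)).restrict_scalars ℝ)
    exact this
  have h2 : ContMDiff (𝓡 1) 𝓘(ℝ, ℂ) ∞ (fun z : Circle => (z : ℂ)) := by
    have : Fact (Module.finrank ℝ ℂ = 1 + 1) := finrank_real_complex_fact'
    exact contMDiff_coe_sphere
  refine (h.contMDiffAt.comp (1 : Circle) h2.contMDiffAt).congr_of_eventuallyEq ?_
  exact Eventually.of_forall fun z => (Complex.log_im z).symm

theorem contMDiffAt_torusCoverSection (k m : ℕ) :
    ContMDiffAt ((torusModel k).prod (𝓡 m)) 𝓘(ℝ, (Fin k → ℝ) × EuclideanSpace ℝ (Fin m)) ∞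
      (torusCoverSection k m) 1 := by
  have h₁ : ContMDiffAt ((torusModel k).prod (𝓡 m)) 𝓘(ℝ, Fin k → ℝ) ∞
      (fun (q : Torus k × VectorGroup m) (i : Fin k) => Complex.arg (q.1 i) / (2 * Real.pi)) 1 := by
    rw [contMDiffAt_pi_space]
    intro i
    have hd : ContDiff ℝ ∞ fun t : ℝ => t / (2 * Real.pi) := by fun_prop
    refine hd.contMDiff.contMDiffAt.comp (1 : Torus k × VectorGroup m) ?_
    refine ContMDiffAt.comp (1 : Torus k × VectorGroup m) (I' := 𝓡 1)
      (g := fun z : Circle => Complex.arg z) (f := fun q : Torus k × VectorGroup m => q.1 i)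
      contMDiffAt_circle_arg_one ?_
    exact ((contMDiff_piEval i).comp contMDiff_fst).contMDiffAt
  have h₂ : ContMDiffAt ((torusModel k).prod (𝓡 m)) (𝓡 m) ∞
      (fun q : Torus k × VectorGroup m => q.2.toAdd) 1 :=
    contMDiffAt_snd
  exact h₁.prodMk_space h₂

end TorusCover

/-! ### Classification from a covering homomorphism, and the compact case -/

/-- A Lie group is isomorphic to `Tᵏ × ℝᵐ` if it is the image of a vector group under a smooth
homomorphism with discrete kernel and a smooth local section. -/
theorem exists_lieGroupIsomorphic_torus_prod {n : ℕ} {G : Type*} [TopologicalSpace G]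
    [ChartedSpace (EuclideanSpace ℝ (Fin n)) G] [Group G] [LieGroup (𝓡 n) ∞ G]
    {P : Multiplicative (EuclideanSpace ℝ (Fin n)) →* G} (hP : Function.Surjective P)
    (hPs : ContMDiff (𝓡 n) (𝓡 n) ∞ P)
    {σ : G → Multiplicative (EuclideanSpace ℝ (Fin n))} (hσ : ContMDiffAt (𝓡 n) (𝓡 n) ∞ σ 1)
    (hPσ : ∀ᶠ g in 𝓝 1, P (σ g) = g)
    (hinj : ∀ᶠ x in 𝓝 (1 : Multiplicative (EuclideanSpace ℝ (Fin n))), P x = 1 → x = 1) :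
    ∃ k ≤ n, LieGroupIsomorphic (𝓡 n) ((torusModel k).prod (𝓡 (n - k)))
      G (Torus k × VectorGroup (n - k)) := by
  let L : Submodule ℤ (EuclideanSpace ℝ (Fin n)) :=
    AddSubgroup.toIntSubmodule (MonoidHom.toAdditiveRight P).ker
  have hL : ∀ x, x ∈ L ↔ P (Multiplicative.ofAdd x) = 1 := fun x => Iff.rfl
  -- `hinj` gives an open set meeting the kernel only in 0.
  have : DiscreteTopology L := by
    obtain ⟨U, hU, hUo, h0⟩ := mem_nhds_iff.1 hinj
    refine discreteTopology_of_isOpen_singleton_zero ?_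
    convert (show IsOpen (U : Set (EuclideanSpace ℝ (Fin n))) from hUo).preimage
      (continuous_subtype_val (p := fun x => x ∈ L)) using 1
    ext x
    refine ⟨?_, fun hx => Subtype.ext (hU hx ((hL _).1 x.2))⟩
    rintro rfl
    exact h0
  obtain ⟨k, hk, A, hA⟩ := exists_continuousLinearEquiv_mem_iff_of_discrete L
  let A' : Multiplicative ((Fin k → ℝ) × EuclideanSpace ℝ (Fin (n - k))) ≃*
    Multiplicative (EuclideanSpace ℝ (Fin n)) := AddEquiv.toMultiplicative A.toLinearEquiv.toAddEquiv
  have hA's : ContMDiff 𝓘(ℝ, (Fin k → ℝ) × EuclideanSpace ℝ (Fin (n - k))) (𝓡 n) ∞ A' :=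
    A.contDiff.contMDiff
  have hA's' : ContMDiff (𝓡 n) 𝓘(ℝ, (Fin k → ℝ) × EuclideanSpace ℝ (Fin (n - k))) ∞ A'.symm :=
    A.symm.contDiff.contMDiff
  refine ⟨k, hk, LieGroupIsomorphic.of_ker_eq
    (J := 𝓘(ℝ, (Fin k → ℝ) × EuclideanSpace ℝ (Fin (n - k))))
    (P := P.comp A'.toMonoidHom) (Q := torusCover k (n - k)) (σ := A'.symm ∘ σ)
    (hP.comp A'.surjective) (torusCover_surjective _ _) ?_ (hPs.comp hA's)
    (contMDiff_torusCover _ _) (hA's'.contMDiffAt.comp 1 hσ) ?_ (contMDiffAt_torusCoverSection _ _)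
    (Eventually.of_forall torusCover_torusCoverSection)⟩
  · ext p
    rw [mem_ker_torusCover]
    exact hA p.toAdd
  · filter_upwards [hPσ] with g hg
    simpa using hg

theorem LieGroupIsomorphic.torus_of_compactSpace {n k : ℕ} (hk : k ≤ n) {G : Type*}
    [TopologicalSpace G] [ChartedSpace (EuclideanSpace ℝ (Fin n)) G] [Group G]
    [LieGroup (𝓡 n) ∞ G] [CompactSpace G]
    (h : LieGroupIsomorphic (𝓡 n) ((torusModel k).prod (𝓡 (n - k)))
      G (Torus k × VectorGroup (n - k))) :
    LieGroupIsomorphic (𝓡 n) (torusModel n) G (Torus n) := by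
  obtain ⟨φ, hφ, hφ'⟩ := h
  have hc : CompactSpace (EuclideanSpace ℝ (Fin (n - k))) := by
    have hs : Function.Surjective fun g => (φ g).2 :=
      Prod.snd_surjective.comp φ.surjective
    exact hs.compactSpace (continuous_snd.comp hφ.continuous)
  have hnk : n - k = 0 := by
    by_contra hne
    have : Nonempty (Fin (n - k)) := ⟨⟨0, by omega⟩⟩
    exact not_compactSpace_iff.2 (inferInstanceAs (NoncompactSpace (EuclideanSpace ℝ (Fin (n - k))))) hc
  obtain rfl : k = n := by omega
  have : Subsingleton (EuclideanSpace ℝ (Fin (k - k))) := by rw [hnk]; infer_instance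
  have : Subsingleton (VectorGroup (k - k)) := this
  have : Unique (VectorGroup (k - k)) := Unique.mk' _
  have hφ₁ : ContMDiff (𝓡 k) (torusModel k) ∞ fun g => (φ g).1 := contMDiff_fst.comp hφ
  refine ⟨φ.trans MulEquiv.prodUnique, hφ₁, ?_⟩
  exact hφ'.comp (contMDiff_id.prodMk contMDiff_const)

/-! ### One-parameter subgroups -/

section OneParameterSubgroup

variable {E : Type*} [NormedAddCommGroup E] [NormedSpace ℝ E] {G : Type*} [TopologicalSpace G]
  [ChartedSpace E G] [Group G] [LieGroup 𝓘(ℝ, E) ∞ G]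

theorem mfderiv_mul_left_mulInvariantVectorField (v : GroupLieAlgebra 𝓘(ℝ, E) G) (g h : G) :
    mfderiv 𝓘(ℝ, E) 𝓘(ℝ, E) (g * ·) h (mulInvariantVectorField v h) =
      mulInvariantVectorField v (g * h) := by
  have hd : ∀ a x : G, MDifferentiableAt 𝓘(ℝ, E) 𝓘(ℝ, E) (a * ·) x := fun a x =>
    (contMDiff_mul_left (I := 𝓘(ℝ, E)) (n := ∞)).mdifferentiableAt (by simp)
  have hc : (fun x => g * h * x) = (g * ·) ∘ (h * ·) := by ext x; simp [mul_assoc]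
  have hm := mfderiv_comp (1 : G) (hd g (h * 1)) (hd h 1)
  simp only [mulInvariantVectorField]
  rw [hc, hm, mul_one]
  rfl

theorem IsMIntegralCurveOn.mul_left {v : GroupLieAlgebra 𝓘(ℝ, E) G} {γ : ℝ → G} {s : Set ℝ}
    (hγ : IsMIntegralCurveOn γ (mulInvariantVectorField (I := 𝓘(ℝ, E)) v) s) (g : G) :
    IsMIntegralCurveOn (fun t => g * γ t) (mulInvariantVectorField (I := 𝓘(ℝ, E)) v) s := by
  intro t ht
  have hd : MDifferentiableAt 𝓘(ℝ, E) 𝓘(ℝ, E) (g * ·) (γ t) :=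
    (contMDiff_mul_left (I := 𝓘(ℝ, E)) (n := ∞)).mdifferentiableAt (by simp)
  have := hd.hasMFDerivAt.comp_hasMFDerivWithinAt t (hγ t ht)
  refine HasMFDerivWithinAt.congr_mfderiv this (ContinuousLinearMap.ext fun r => ?_)
  change mfderiv 𝓘(ℝ, E) 𝓘(ℝ, E) (g * ·) (γ t) ((1 : ℝ →L[ℝ] ℝ) r • mulInvariantVectorField v (γ t))
    = (1 : ℝ →L[ℝ] ℝ) r • mulInvariantVectorField v (g * γ t)
  rw [ContinuousLinearMap.map_smul, mfderiv_mul_left_mulInvariantVectorField]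

/-- The subgroup is the integral curve through 1 of the left-invariant field with value `v` at 1. -/
theorem exists_oneParameterSubgroup [CompleteSpace E] [T2Space G] (v : E) :
    ∃ γ : Multiplicative ℝ →* G, Continuous (γ : ℝ → G) ∧
      HasDerivAt (fun t : ℝ => extChartAt 𝓘(ℝ, E) (1 : G) (γ (Multiplicative.ofAdd t))) v 0 := by
  have : LieGroup 𝓘(ℝ, E) (minSmoothness ℝ 3) G := by
    simp only [minSmoothness_of_isRCLikeNormedField]
    exact LieGroup.of_le (n := ∞) (WithTop.coe_le_coe.2 (le_top : (3 : ℕ∞) ≤ ⊤))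
  have : IsManifold 𝓘(ℝ, E) 1 G := IsManifold.of_le (n := ∞) (by exact_mod_cast le_top)
  let V : GroupLieAlgebra 𝓘(ℝ, E) G := v
  let X := mulInvariantVectorField (I := 𝓘(ℝ, E)) (G := G) V
  have hX : ContMDiff 𝓘(ℝ, E) 𝓘(ℝ, E).tangent 1 (fun x => (⟨x, X x⟩ : TangentBundle 𝓘(ℝ, E) G)) :=
    (contMDiff_mulInvariantVectorField V).of_le (by simp [minSmoothness_of_isRCLikeNormedField])
  obtain ⟨γ₀, hγ₀, hi⟩ :=
    exists_isMIntegralCurveAt_of_contMDiffAt_boundaryless 0 (hX.contMDiffAt (x := 1))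
  obtain ⟨ε, hε, hi⟩ := isMIntegralCurveAt_iff'.1 hi
  rw [Real.ball_eq_Ioo, zero_sub, zero_add] at hi
  obtain ⟨γ, h0, hγ⟩ := exists_isMIntegralCurve_of_isMIntegralCurveOn hX hε
    -- Left translates of one local curve start at every point and share the lifetime `ε`, so the
    -- field is complete.
    (fun g => ⟨fun t => g * γ₀ t, by simp [hγ₀], hi.mul_left g⟩) 1
  -- Both sides, as functions of `t`, are integral curves with value `γ s` at 0; uniqueness
  -- identifies them.
  have hmul : ∀ s t, γ (s + t) = γ s * γ t := fun s t => by
    have h₁ : IsMIntegralCurve (fun t => γ s * γ t) X := by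
      rw [isMIntegralCurve_iff_isMIntegralCurveOn] at hγ ⊢
      exact hγ.mul_left (γ s)
    have h₂ : IsMIntegralCurve (γ ∘ (· + s)) X := hγ.comp_add s
    have := isMIntegralCurve_Ioo_eq_of_contMDiff_boundaryless (t₀ := 0) hX h₂ h₁ (by simp [h0])
    rw [add_comm]
    exact congrFun this t
  refine ⟨⟨⟨γ, h0⟩, hmul⟩, ?_, ?_⟩
  · exact continuous_iff_continuousAt.2 fun t => (hγ t).continuousAt
  · have h := (hγ 0).2
    have hX0 : X (γ 0) = (v : E) := by
      rw [h0]
      exact congrArg (fun f : E →L[ℝ] E => f v) ((hasMFDerivAt_id (I := 𝓘(ℝ, E))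
        (1 : G)).congr_of_eventuallyEq (Eventually.of_forall one_mul)).mfderiv
    rw [hX0] at h
    have h' : HasFDerivAt (extChartAt 𝓘(ℝ, E) (γ 0) ∘ γ)
        ((1 : ℝ →L[ℝ] ℝ).smulRight v) (0 : ℝ) := by
      rw [modelWithCornersSelf_coe, range_id] at h
      exact h.hasFDerivAt univ_mem
    rw [h0] at h'
    have h'' := h'.hasDerivAt
    rw [ContinuousLinearMap.smulRight_apply, one_apply_eq_self, one_smul] at h''
    exact h''

/-- The homomorphism law turns differentiability at 0 into an autonomous ODE with smooth right-hand
side in the chart at 1; its solutions are smooth. -/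
theorem MonoidHom.contMDiff_of_hasDerivAt [CompleteSpace E] (γ : Multiplicative ℝ →* G)
    (hγ : Continuous (γ : ℝ → G)) {v : E} (hv : HasDerivAt
      (fun t : ℝ => extChartAt 𝓘(ℝ, E) (1 : G) (γ (Multiplicative.ofAdd t))) v 0) :
    ContMDiff 𝓘(ℝ, ℝ) 𝓘(ℝ, E) ∞ γ := by
  have hman : IsManifold 𝓘(ℝ, E) ∞ G := ContMDiffMul.toIsManifold
  let φ := extChartAt 𝓘(ℝ, E) (1 : G)
  let c : ℝ → E := fun t => φ (γ (Multiplicative.ofAdd t))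
  have hγ0 : γ (Multiplicative.ofAdd 0) = 1 := map_one γ
  have hγadd : ∀ s t : ℝ, γ (Multiplicative.ofAdd (s + t)) =
    γ (Multiplicative.ofAdd s) * γ (Multiplicative.ofAdd t) := fun s t => map_mul γ _ _
  let m : E → E → E := fun y z => φ (φ.symm y * φ.symm z)
  have hφ1 : φ.symm (φ 1) = 1 := extChartAt_to_inv (I := 𝓘(ℝ, E)) 1
  have hsymm : ContMDiffAt 𝓘(ℝ, E) 𝓘(ℝ, E) ∞ φ.symm (φ 1) :=
    (contMDiffOn_extChartAt_symm 1).contMDiffAt (extChartAt_target_mem_nhds 1)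
  have hφs : ContMDiffAt 𝓘(ℝ, E) 𝓘(ℝ, E) ∞ φ 1 := contMDiffAt_extChartAt
  have hm : ContDiffAt ℝ ∞ (Function.uncurry m) (φ 1, φ 1) := by
    rw [← contMDiffAt_iff_contDiffAt]
    have h1 : ContMDiffAt 𝓘(ℝ, E × E) 𝓘(ℝ, E) ∞ (fun p : E × E => φ.symm p.1) (φ 1, φ 1) :=
      ContMDiffAt.comp (φ 1, φ 1) (g := φ.symm) (f := Prod.fst) hsymm
        contDiff_fst.contMDiff.contMDiffAt
    have h2 : ContMDiffAt 𝓘(ℝ, E × E) 𝓘(ℝ, E) ∞ (fun p : E × E => φ.symm p.2) (φ 1, φ 1) :=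
      ContMDiffAt.comp (φ 1, φ 1) (g := φ.symm) (f := Prod.snd) hsymm
        contDiff_snd.contMDiff.contMDiffAt
    refine ContMDiffAt.comp (φ 1, φ 1) (g := φ) (f := fun p : E × E => φ.symm p.1 * φ.symm p.2)
      ?_ (h1.mul h2)
    simpa [hφ1] using hφs
  -- Near 0, `c u = m (c s) (c (u - s))`; differentiating in `u` at `u = s` gives `c' s = F (c s)`.
  let F : E → E := fun y => fderiv ℝ (m y) (φ 1) v
  have hF : ContDiffAt ℝ ∞ F (φ 1) :=
    (ContDiffAt.fderiv (g := fun _ => φ 1) hm contDiffAt_const (by simp)).clm_apply contDiffAt_const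
  have hc0 : c 0 = φ 1 := by simp only [c, hγ0]
  have hsrc : ∀ᶠ t : ℝ in 𝓝 0, γ (Multiplicative.ofAdd t) ∈ φ.source := by
    refine hγ.continuousAt (x := (0 : ℝ)) ?_
    exact (show γ 1 = 1 from map_one γ) ▸ extChartAt_source_mem_nhds (1 : G)
  have hcc : ContinuousAt c 0 := hv.continuousAt
  have hmd : ∀ᶠ s : ℝ in 𝓝 0, DifferentiableAt ℝ (m (c s)) (φ 1) := by
    have h1 := (hm.of_le (m := 1) (by simp)).eventually (by simp)
    have h2 : ContinuousAt (fun s : ℝ => (c s, φ 1)) 0 := hcc.prodMk continuousAt_const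
    have h3 := h2.eventually (p := fun p => ContDiffAt ℝ 1 (Function.uncurry m) p)
      (by simpa only [hc0] using h1)
    filter_upwards [h3] with s hs
    exact (hs.differentiableAt (by simp)).comp (φ 1)
      ((differentiableAt_const _).prodMk differentiableAt_id)
  have hode : ∀ᶠ s : ℝ in 𝓝 0, HasDerivAt c (F (c s)) s := by
    filter_upwards [hmd, hsrc] with s hs hss
    have h1 : HasDerivAt (fun u => c (u - s)) v s := by
      have h := hv
      rw [← sub_self s] at h
      exact h.comp_sub_const s s
    have h2 : HasDerivAt (fun u => m (c s) (c (u - s))) (F (c s)) s := by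
      refine HasFDerivAt.comp_hasDerivAt s (l := m (c s)) ?_ h1
      rw [sub_self, hc0]
      exact hs.hasFDerivAt
    refine h2.congr_of_eventuallyEq ?_
    have h3 : Tendsto (fun u => u - s) (𝓝 s) (𝓝 0) := by
      have : Continuous fun u : ℝ => u - s := by fun_prop
      simpa using this.tendsto s
    filter_upwards [h3.eventually hsrc] with u hu
    simp only [m, c]
    rw [φ.left_inv hss, φ.left_inv hu, ← hγadd, add_sub_cancel]
  have hcs : ContDiffAt ℝ ∞ c 0 := by
    rw [contDiffAt_infty]
    -- One finite order at a time, as the neighbourhood on which `F` is known to be `N` times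
    -- continuously differentiable may depend on `N`.
    intro N
    obtain ⟨u, hu, hFu⟩ := (hF.of_le (m := N) (by exact_mod_cast le_top)).contDiffOn le_rfl (by simp)
    have hcu : ∀ᶠ s : ℝ in 𝓝 0, c s ∈ u := hcc (by rw [hc0]; simpa using hu)
    obtain ⟨ε, hε, h⟩ := Metric.eventually_nhds_iff_ball.1 (hode.and hcu)
    have hsub : ∀ t ∈ Icc (-(ε / 2)) (ε / 2), t ∈ Metric.ball (0 : ℝ) ε := fun t ht => by
      rw [mem_ball_zero_iff, Real.norm_eq_abs]
      exact (abs_le.2 ht).trans_lt (by linarith)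
    refine ContDiffOn.contDiffAt (s := Icc (-(ε / 2)) (ε / 2)) ?_
      (Icc_mem_nhds (by linarith) (by linarith))
    refine ODE.contDiffOn_enat_Icc_of_hasDerivWithinAt (n := N) (f := fun _ => F) (u := u) ?_
      (fun t ht => (h t (hsub t ht)).1.hasDerivWithinAt) fun t ht => (h t (hsub t ht)).2
    exact hFu.comp contDiff_snd.contDiffOn fun p hp => hp.2
  refine MonoidHom.contMDiff_of_contMDiffAt_one (I := 𝓘(ℝ, ℝ)) γ ?_
  have h1 : ContMDiffAt 𝓘(ℝ, ℝ) 𝓘(ℝ, E) ∞ (fun t : ℝ => φ.symm (c t)) 0 :=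
    ContMDiffAt.comp (0 : ℝ) (g := φ.symm) (by rw [hc0]; exact hsymm) hcs.contMDiffAt
  refine ContMDiffAt.congr_of_eventuallyEq h1 ?_
  filter_upwards [hsrc] with t ht
  exact (φ.left_inv ht).symm

end OneParameterSubgroup

/-! ### The exponential map of an abelian Lie group -/

/-- An abelian Lie group has an exponential map: a smooth homomorphism from a vector group whose
derivative at the origin is the identity. -/
theorem exists_contMDiff_monoidHom_hasFDerivAt_id (n : ℕ) (G : Type*) [TopologicalSpace G]
    [T2Space G] [ChartedSpace (EuclideanSpace ℝ (Fin n)) G] [CommGroup G] [LieGroup (𝓡 n) ∞ G] :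
    ∃ P : Multiplicative (EuclideanSpace ℝ (Fin n)) →* G, ContMDiff (𝓡 n) (𝓡 n) ∞ P ∧
      ContDiffAt ℝ ∞ (fun x : EuclideanSpace ℝ (Fin n) =>
        extChartAt (𝓡 n) (1 : G) (P (Multiplicative.ofAdd x))) 0 ∧
      HasFDerivAt (fun x : EuclideanSpace ℝ (Fin n) =>
        extChartAt (𝓡 n) (1 : G) (P (Multiplicative.ofAdd x)))
        (ContinuousLinearMap.id ℝ (EuclideanSpace ℝ (Fin n))) 0 := by
  have hman : IsManifold (𝓡 n) ∞ G := ContMDiffMul.toIsManifold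
  choose γ hγc hγd using fun i : Fin n =>
    exists_oneParameterSubgroup (G := G) (EuclideanSpace.single i (1 : ℝ))
  let P : Multiplicative (EuclideanSpace ℝ (Fin n)) →* G :=
    { toFun := fun x => ∏ i, γ i (Multiplicative.ofAdd (x.toAdd i))
      map_one' := Finset.prod_eq_one fun i _ => map_one (γ i)
      map_mul' := fun x y => by
        -- Commutativity of `G` is essential here.
        rw [← Finset.prod_mul_distrib]
        exact Finset.prod_congr rfl fun i _ => map_mul (γ i) _ _ }
  have hP : ContMDiff (𝓡 n) (𝓡 n) ∞ P := by
    have hi : ∀ i, ContMDiff (𝓡 n) (𝓡 n) ∞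
        fun x : EuclideanSpace ℝ (Fin n) => γ i (Multiplicative.ofAdd (x i)) := fun i =>
      ((γ i).contMDiff_of_hasDerivAt (hγc i) (hγd i)).comp (I' := 𝓘(ℝ, ℝ))
        (EuclideanSpace.proj (𝕜 := ℝ) i).contDiff.contMDiff
    exact contMDiff_finsetProd (t := Finset.univ) fun i _ => hi i
  have hP1 : P (Multiplicative.ofAdd 0) = 1 := map_one P
  have hc : ContDiffAt ℝ ∞ (fun x : EuclideanSpace ℝ (Fin n) =>
      extChartAt (𝓡 n) (1 : G) (P (Multiplicative.ofAdd x))) 0 := by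
    rw [← contMDiffAt_iff_contDiffAt]
    refine ContMDiffAt.comp (0 : EuclideanSpace ℝ (Fin n)) (g := extChartAt (𝓡 n) (1 : G))
      (f := fun x : EuclideanSpace ℝ (Fin n) => P (Multiplicative.ofAdd x)) ?_ hP.contMDiffAt
    rw [hP1]
    exact contMDiffAt_extChartAt
  refine ⟨P, hP, hc, ?_⟩
  have hd := (hc.differentiableAt (by simp)).hasFDerivAt
  refine hd.congr_fderiv ?_
  -- On the `i`-th axis `P` is `γ i`, so its derivative sends the `i`-th basis vector to itself.
  refine ContinuousLinearMap.coe_injective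
    ((EuclideanSpace.basisFun (Fin n) ℝ).toBasis.ext fun i => ?_)
  have hline : HasDerivAt (fun t : ℝ => t • EuclideanSpace.single i (1 : ℝ))
      (EuclideanSpace.single i (1 : ℝ)) 0 := by
    simpa using (hasDerivAt_id (0 : ℝ)).smul_const (EuclideanSpace.single i (1 : ℝ))
  have h₁ := HasFDerivAt.comp_hasDerivAt_of_eq (0 : ℝ) hd hline (by simp)
  have h₂ : ∀ t : ℝ, P (Multiplicative.ofAdd (t • EuclideanSpace.single i (1 : ℝ))) =
      γ i (Multiplicative.ofAdd t) := fun t => by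
    change ∏ j, γ j (Multiplicative.ofAdd ((t • EuclideanSpace.single i (1 : ℝ)) j)) = _
    rw [Finset.prod_eq_single i]
    · simp
    · intro j _ hj
      simp [hj]
    · simp
  have h₃ := h₁.unique ((hγd i).congr_of_eventuallyEq (Eventually.of_forall fun t => by
    simp only [Function.comp_apply, h₂]))
  simpa using h₃

/-- The exponential map of an abelian Lie group is a local diffeomorphism at the identity. -/
theorem exists_contMDiff_monoidHom_local_section (n : ℕ) (G : Type*) [TopologicalSpace G]
    [T2Space G] [ChartedSpace (EuclideanSpace ℝ (Fin n)) G] [CommGroup G] [LieGroup (𝓡 n) ∞ G] :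
    ∃ (P : Multiplicative (EuclideanSpace ℝ (Fin n)) →* G)
      (σ : G → Multiplicative (EuclideanSpace ℝ (Fin n))), ContMDiff (𝓡 n) (𝓡 n) ∞ P ∧
      ContMDiffAt (𝓡 n) (𝓡 n) ∞ σ 1 ∧ (∀ᶠ g in 𝓝 1, P (σ g) = g) ∧
      ∀ᶠ x in 𝓝 (1 : Multiplicative (EuclideanSpace ℝ (Fin n))), P x = 1 → x = 1 := by
  have hman : IsManifold (𝓡 n) ∞ G := ContMDiffMul.toIsManifold
  obtain ⟨P, hP, hc, hd⟩ := exists_contMDiff_monoidHom_hasFDerivAt_id n G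
  set φ := extChartAt (𝓡 n) (1 : G)
  set h : EuclideanSpace ℝ (Fin n) → EuclideanSpace ℝ (Fin n) :=
    fun x => φ (P (Multiplicative.ofAdd x))
  have hP1 : P (Multiplicative.ofAdd 0) = 1 := map_one P
  have hh0 : h 0 = φ 1 := by simp only [h, hP1]
  have hd' : HasFDerivAt h
    (ContinuousLinearEquiv.refl ℝ (EuclideanSpace ℝ (Fin n)) : _ →L[ℝ] _) 0 := hd
  have hs := hc.hasStrictFDerivAt' hd' (by simp)
  let inv := hs.localInverse
  have hinv : ContDiffAt ℝ ∞ inv (φ 1) := by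
    rw [← hh0]
    exact hc.to_localInverse hd' (by simp)
  have hleft : ∀ᶠ x in 𝓝 0, inv (h x) = x := hs.eventually_left_inverse
  have hright : ∀ᶠ y in 𝓝 (φ 1), h (inv y) = y := by
    rw [← hh0]; exact hs.eventually_right_inverse
  have hinv1 : inv (φ 1) = 0 := by
    rw [← hh0]; exact hs.localInverse_apply_image
  have hφ : ContMDiffAt (𝓡 n) (𝓡 n) ∞ φ 1 := contMDiffAt_extChartAt
  have hσ : ContMDiffAt (𝓡 n) (𝓡 n) ∞ (fun g => inv (φ g)) 1 := hinv.contMDiffAt.comp 1 hφ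
  refine ⟨P, fun g => Multiplicative.ofAdd (inv (φ g)), hP, hσ, ?_, ?_⟩
  · have hcont : ContinuousAt (fun g => P (Multiplicative.ofAdd (inv (φ g)))) 1 :=
      ContinuousAt.comp (g := P) hP.continuous.continuousAt hσ.continuousAt
    have hsrc : ∀ᶠ g in 𝓝 1, P (Multiplicative.ofAdd (inv (φ g))) ∈ φ.source := by
      refine hcont ?_
      simp only [hinv1, hP1]
      exact extChartAt_source_mem_nhds (1 : G)
    filter_upwards [hsrc, extChartAt_source_mem_nhds (I := 𝓡 n) (1 : G),
      hφ.continuousAt.eventually hright] with g h₁ h₂ h₃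
    -- The inverse function theorem only equates the chart images; injectivity needs both points in
    -- the chart domain, hence `hsrc`.
    exact φ.injOn h₁ h₂ h₃
  · refine Eventually.mono (hleft : ∀ᶠ x : EuclideanSpace ℝ (Fin n) in 𝓝 0, _) fun x hx hPx => ?_
    have : h x = φ 1 := congrArg φ hPx
    rw [this, hinv1] at hx
    exact hx.symm

/-- A homomorphism to a connected group whose range is a neighbourhood of the identity is
surjective. -/
theorem MonoidHom.surjective_of_eventually_mem_range {W G : Type*} [Group W] [Group G]
    [TopologicalSpace G] [IsTopologicalGroup G] [ConnectedSpace G] (P : W →* G)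
    (h : ∀ᶠ g in 𝓝 1, g ∈ P.range) : Function.Surjective P := by
  rw [← MonoidHom.range_eq_top]
  have ho : IsOpen (P.range : Set G) := Subgroup.isOpen_of_mem_nhds _ h
  refine SetLike.coe_injective ?_
  -- An open subgroup is closed, its complement being a union of open cosets.
  exact IsClopen.eq_univ ⟨Subgroup.isClosed_of_isOpen _ ho, ho⟩ ⟨1, one_mem _⟩

theorem mainTheorem5 (n : ℕ) (G : Type*) [TopologicalSpace G] [T2Space G]
    [SecondCountableTopology G] [ChartedSpace (EuclideanSpace ℝ (Fin n)) G] [CommGroup G]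
    [LieGroup (𝓡 n) ∞ G] [ConnectedSpace G] :
    (∃ k ≤ n, LieGroupIsomorphic (𝓡 n) ((torusModel k).prod (𝓡 (n - k)))
      G (Torus k × VectorGroup (n - k))) ∧
    (CompactSpace G → LieGroupIsomorphic (𝓡 n) (torusModel n) G (Torus n)) := by
  obtain ⟨P, σ, hP, hσ, hPσ, hinj⟩ := exists_contMDiff_monoidHom_local_section n G
  have : IsTopologicalGroup G := topologicalGroup_of_lieGroup (𝓡 n) ∞
  have hsurj : Function.Surjective P :=
    P.surjective_of_eventually_mem_range (hPσ.mono fun g hg => ⟨σ g, hg⟩)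
  have hmain := exists_lieGroupIsomorphic_torus_prod hsurj hP hσ hPσ hinj
  refine ⟨hmain, fun _ => ?_⟩
  obtain ⟨k, hk, h⟩ := hmain
  exact h.torus_of_compactSpace hk
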